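/- A Čech closure operator on a set $X$ is a map $c:2^X\to 2^X$ with $c(\varnothing)=\varnothing$, $A\subseteq c(A)$ and $c(A\cup B)=c(A)\cup c(B)$ for all $A,B\subseteq X$; the pair $(X,c)$ is a closure space, and a map $f:(X,c)\to(Y,d)$ of closure spaces is continuous if $f(c(A))\subseteq d(f(A))$ for all $A\subseteq X$. The singular homology $H_k(X,c)$, $k\ge 0$, is the homology of the chain complex whose $n$-th group is the free abelian group on the continuous maps $\sigma:|\Delta^n|\to (X,c)$, where the standard simplex $|\Delta^n|$ carries the closure operator of its Euclidean topology, with boundary $\partial\sigma=\sum_{i=0}^n(-1)^i\sigma|_{[e_0,\dots,\hat e_i,\dots,e_n]}$. For $n\ge 1$ and $m\ge 0$ let $(\mathbb{Z}_n,c_m)$ be the set $\mathbb{Z}_n=\{0,\dots,n-1\}$ of integers mod $n$ with $c_m(A)=\{j\in\mathbb{Z}_n : d(i,j)\le m \text{ for some } i\in A\}$, where $d(i,j)=\min\{|k| : k\in\mathbb{Z},\ k\equiv i-j \bmod n\}$. Theorem. For all integers $m\ge 5$ and $k\ge 0$ there is an isomorphism of abelian groups $$H_k(\mathbb{Z}_{4m-4},c_m)\cong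 H_k(\mathbb{Z}_{4m},c_{m+1}).$$ -/

import Mathlib

open CategoryTheory

/-- A Čech closure operator on a set `X`. It is not required to be idempotent. -/
structure CechClosure (X : Type) where
  cl : Set X → Set X
  cl_empty : cl ∅ = ∅
  subset_cl : ∀ A, A ⊆ cl A
  cl_union : ∀ A B, cl (A ∪ B) = cl A ∪ cl B

namespace CechClosure

/-- The (Kuratowski) closure operator of a topological space. -/
def ofTopology (X : Type) [TopologicalSpace X] : CechClosure X where
  cl := closure
  cl_empty := closure_empty
  subset_cl _ := subset_closure
  cl_union _ _ := closure_union

/-- A map `f : (X, c) → (Y, d)` of closure spaces is continuous if `f (c A) ⊆ d (f A)`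
for every `A ⊆ X`. -/
def IsContinuous {X Y : Type} (c : CechClosure X) (d : CechClosure Y) (f : X → Y) : Prop :=
  ∀ A : Set X, f '' c.cl A ⊆ d.cl (f '' A)

theorem IsContinuous.comp {X Y Z : Type} {c : CechClosure X} {d : CechClosure Y}
    {e : CechClosure Z} {g : Y → Z} {f : X → Y}
    (hg : IsContinuous d e g) (hf : IsContinuous c d f) : IsContinuous c e (g ∘ f) := by
  intro A
  rw [Set.image_comp, Set.image_comp]
  exact (Set.image_mono (hf A)).trans (hg _)

/-- Between topological spaces, continuity of closure spaces is ordinary continuity. -/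
theorem isContinuous_ofTopology_iff {X Y : Type} [TopologicalSpace X] [TopologicalSpace Y]
    {f : X → Y} : IsContinuous (ofTopology X) (ofTopology Y) f ↔ Continuous f :=
  continuous_iff_image_closure_subset_closure_image.symm

/-- The singular `n`-simplices of a closure space `(X, c)`: the continuous maps
`|Δⁿ| → (X, c)`, where `|Δⁿ|` carries the closure operator of its Euclidean topology. -/
def SingularSimplex {X : Type} (c : CechClosure X) (n : ℕ) : Type :=
  {σ : stdSimplex ℝ (Fin (n + 1)) → X // IsContinuous (ofTopology _) c σ}

/-- Precomposition of a singular simplex with the affine map of standard simplices induced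
by a map `f` of the sets of vertices. -/
noncomputable def SingularSimplex.pullback {X : Type} {c : CechClosure X} {n p : ℕ}
    (f : Fin (p + 1) → Fin (n + 1)) (σ : SingularSimplex c n) : SingularSimplex c p :=
  ⟨σ.1 ∘ stdSimplex.map f, IsContinuous.comp (d := ofTopology (stdSimplex ℝ (Fin (n + 1)))) σ.2
    (isContinuous_ofTopology_iff.2 (stdSimplex.continuous_map f))⟩

theorem SingularSimplex.pullback_id {X : Type} {c : CechClosure X} {n : ℕ}
    (σ : SingularSimplex c n) : σ.pullback id = σ :=
  Subtype.ext (funext fun x => congrArg σ.1 (stdSimplex.map_id_apply x))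

theorem SingularSimplex.pullback_pullback {X : Type} {c : CechClosure X} {n p q : ℕ}
    (f : Fin (p + 1) → Fin (n + 1)) (g : Fin (q + 1) → Fin (p + 1)) (σ : SingularSimplex c n) :
    (σ.pullback f).pullback g = σ.pullback (f ∘ g) :=
  Subtype.ext (funext fun x => congrArg σ.1 (stdSimplex.map_comp_apply g f x))

/-- The singular simplicial set of a closure space: simplicial operators act by
precomposition with the affine maps of standard simplices. -/
noncomputable def singularSet {X : Type} (c : CechClosure X) : SSet.{0} where
  obj n := SingularSimplex c n.unop.len
  map f := TypeCat.ofHom fun σ => SingularSimplex.pullback (fun i => f.unop.toOrderHom i) σ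
  map_id n := by
    ext σ
    exact SingularSimplex.pullback_id σ
  map_comp f g := by
    ext σ
    exact (SingularSimplex.pullback_pullback (fun i => f.unop.toOrderHom i)
      (fun i => g.unop.toOrderHom i) σ).symm

/-- The singular homology group `H_k(X, c)` with integer coefficients: the `k`-th homology of
the complex of free abelian groups on the singular simplices, with the alternating sum of
the faces as boundary. -/
noncomputable def singularHomology {X : Type} (c : CechClosure X) (k : ℕ) : ModuleCat.{0} ℤ :=
  c.singularSet.homology (ModuleCat.of ℤ ℤ) k

end CechClosure

/-- The distance on `ℤ/n`: the least absolute value of an integer in the class of `i - j`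
(see `ZMod.isLeast_cyclicDist`). -/
def ZMod.cyclicDist {n : ℕ} (i j : ZMod n) : ℕ := (i - j).valMinAbs.natAbs

theorem ZMod.isLeast_cyclicDist {n : ℕ} (i j : ZMod n) :
    IsLeast {a : ℕ | ∃ k : ℤ, (k : ZMod n) = i - j ∧ k.natAbs = a} (ZMod.cyclicDist i j) := by
  refine ⟨⟨_, ZMod.coe_valMinAbs _, rfl⟩, ?_⟩
  rintro _ ⟨k, hk, rfl⟩
  unfold ZMod.cyclicDist
  rw [← hk]
  rcases Nat.eq_zero_or_pos n with rfl | hn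
  · exact le_rfl
  · have : NeZero n := ⟨hn.ne'⟩
    by_cases h : k.natAbs ≤ n / 2
    · exact ZMod.natAbs_min_of_le_div_two n _ k (by simp) (ZMod.natAbs_valMinAbs_le _)
    · exact (ZMod.natAbs_valMinAbs_le _).trans (not_le.1 h).le

/-- The closure operator `c_m` on `ℤ/n`: `c_m(A)` is the set of all points at distance
at most `m` from some point of `A`. -/
def rootsOfUnityClosure (n m : ℕ) : CechClosure (ZMod n) where
  cl A := ⋃ i ∈ A, {j | ZMod.cyclicDist i j ≤ m}
  cl_empty := by simp
  subset_cl A x hx := Set.mem_biUnion hx (by simp [ZMod.cyclicDist])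
  cl_union A B := Set.biUnion_union A B _

/-!
For `1 ≤ m` and `3 * m < n` the closure space `(ℤ/n, c_m)` has the singular homology of a circle;
both spaces of the theorem are of this kind, since `3 * m < 4 * m - 4` and `3 * (m + 1) < 4 * m`
for `m ≥ 5`.

The proof treats `ℤ`, with the closure operator of the relation `|i - j| ≤ m`, as the universal cover
of `ℤ/n`. A map from a topological space to one of these spaces is continuous iff near each point its
values stay within `m` of the value at the point. The condition `3 * m < n` says that adjacent points
of an arc of radius `m` in `ℤ/n` are still adjacent after lifting the arc to an interval of `ℤ`.
Hence continuous maps lift locally. On a compact convex set, local lifts are compared along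
segments and patched to a global lift (`exists_isLiftOn_univ`), which is unique up to a multiple of
`n`. Thus the singular set of `ℤ/n` is the quotient of that of `ℤ` by a free action of `ℤ`
(`isFreeQuotient_reduction`).

The singular set of `ℤ` is contractible: scaling a simplex to `0` and rounding to the nearest
integer is continuous for `m ≥ 1`, and the resulting cones are an extra degeneracy
(`coneSimplex`, `intExtraDegeneracy`).

If `T` generates the free action, `0 ⟶ C(ℤ) ⟶ C(ℤ) ⟶ C(ℤ/n) ⟶ 0`, with first map `T - 1`, is a short
exact sequence of singular chain complexes (`SSet.IsFreeQuotient.shortExact`). As `T` acts trivially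
on the homology of the contractible `ℤ`, the long exact sequence identifies `H₀` and `H₁` of `ℤ/n`
with `H₀` of `ℤ`, and shows that the higher groups vanish (`SSet.IsFreeQuotient.homology`).
-/

open Topology Filter

/-! ### Lifting locally `m`-varying maps from `ℤ/n` to `ℤ` -/

theorem ZMod.cyclicDist_le_iff {n m : ℕ} (i j : ZMod n) :
    ZMod.cyclicDist i j ≤ m ↔ ∃ k : ℤ, (k : ZMod n) = j - i ∧ |k| ≤ m := by
  constructor
  · intro h
    refine ⟨-(i - j).valMinAbs, by simp, ?_⟩
    rw [abs_neg, Int.abs_eq_natAbs]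
    exact_mod_cast h
  · rintro ⟨k, hk, hkm⟩
    refine ((ZMod.isLeast_cyclicDist i j).2 ⟨-k, by simp [hk], rfl⟩).trans ?_
    rw [Int.natAbs_neg]
    rw [Int.abs_eq_natAbs] at hkm
    exact_mod_cast hkm

theorem ZMod.cyclicDist_comm {n : ℕ} (i j : ZMod n) :
    ZMod.cyclicDist i j = ZMod.cyclicDist j i := by
  rw [ZMod.cyclicDist, ← neg_sub, ZMod.natAbs_valMinAbs_neg]; rfl

theorem Int.eq_zero_of_dvd_of_abs_le {n m : ℕ} (h : m < n) {a : ℤ} (hd : (n : ℤ) ∣ a)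
    (ha : |a| ≤ m) : a = 0 :=
  Int.eq_zero_of_abs_lt_dvd hd (ha.trans_lt (by exact_mod_cast h))

section Lifting

variable {K : Type*} [TopologicalSpace K] {n m : ℕ}

/-- On the set `U`, the integer-valued function `L` reduces to `f` modulo `n`, and around each
point of `U` its values stay within `m` of the value at the point. -/
def IsLiftOn (m : ℕ) (f : K → ZMod n) (L : K → ℤ) (U : Set K) : Prop :=
  ∀ y ∈ U, (L y : ZMod n) = f y ∧ ∀ᶠ z in 𝓝 y, |L z - L y| ≤ m

theorem IsLiftOn.mono {f : K → ZMod n} {L : K → ℤ} {U V : Set K} (h : IsLiftOn m f L U)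
    (hV : V ⊆ U) : IsLiftOn m f L V :=
  fun y hy => h y (hV hy)

/-- Two lifts on a connected open set differ by a constant: their difference is a multiple of `n`
whose local oscillation is at most `2 * m < n`. -/
theorem IsLiftOn.sub_eq_sub (hmn : 2 * m < n) {f : K → ZMod n} {L L' : K → ℤ} {U : Set K}
    (hU : IsOpen U) (hc : IsPreconnected U) (hL : IsLiftOn m f L U) (hL' : IsLiftOn m f L' U)
    {y z : K} (hy : y ∈ U) (hz : z ∈ U) : L z - L y = L' z - L' y := by
  have key : ContinuousOn (fun x => L x - L' x) U := by
    intro x hx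
    refine ContinuousAt.continuousWithinAt (tendsto_const_nhds.congr' ?_)
    filter_upwards [(hL x hx).2, (hL' x hx).2, hU.mem_nhds hx] with w h1 h2 hw
    have hd : ((n : ℕ) : ℤ) ∣ (L x - L' x) - (L w - L' w) := by
      rw [← ZMod.intCast_zmod_eq_zero_iff_dvd]
      push_cast
      rw [(hL x hx).1, (hL' x hx).1, (hL w hw).1, (hL' w hw).1]
      ring
    have := Int.eq_zero_of_dvd_of_abs_le hmn hd (by
      push_cast
      rw [abs_le] at *
      constructor <;> linarith [h1.1, h1.2, h2.1, h2.2])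
    linarith
  have := hc.constant key hy hz
  linarith

/-- A locally `m`-varying map to `ZMod n` lifts to `ℤ` near each point, as soon as
`3 * m < n`: the arc of radius `m` around a point lifts to an interval, and two points of the arc
at distance at most `m` have lifts at distance at most `m`. -/
theorem exists_isLiftOn_nhds (hmn : 3 * m < n) {f : K → ZMod n}
    (hf : ∀ x, ∀ᶠ y in 𝓝 x, ZMod.cyclicDist (f x) (f y) ≤ m) (x : K) :
    ∃ U : Set K, IsOpen U ∧ x ∈ U ∧ ∃ L, IsLiftOn m f L U := by
  obtain ⟨U, hU, hUo, hxU⟩ := eventually_nhds_iff.1 (hf x)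
  have h1 : ∀ y, ∃ k : ℤ, (k : ZMod n) = f y - f x ∧ (y ∈ U → |k| ≤ m) := fun y => by
    by_cases hy : y ∈ U
    · obtain ⟨k, hk, hk'⟩ := (ZMod.cyclicDist_le_iff _ _).1 (hU y hy)
      exact ⟨k, hk, fun _ => hk'⟩
    · obtain ⟨k, hk⟩ := ZMod.intCast_surjective (f y - f x)
      exact ⟨k, hk, fun h => absurd h hy⟩
  choose l hl hlm using h1
  obtain ⟨a, ha⟩ := ZMod.intCast_surjective (f x)
  refine ⟨U, hUo, hxU, fun y => a + l y, fun y hy => ⟨by simp [ha, hl], ?_⟩⟩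
  filter_upwards [hUo.mem_nhds hy, hf y] with z hz hyz
  obtain ⟨k, hk, hkm⟩ := (ZMod.cyclicDist_le_iff _ _).1 hyz
  have hd : ((n : ℕ) : ℤ) ∣ (l z - l y) - k := by
    rw [← ZMod.intCast_zmod_eq_zero_iff_dvd]
    push_cast
    rw [hl, hl, hk]
    ring
  have := Int.eq_zero_of_dvd_of_abs_le hmn hd (by
    have h1 := hlm y hy
    have h2 := hlm z hz
    push_cast
    rw [abs_le] at *
    constructor <;> linarith [h1.1, h1.2, h2.1, h2.2, hkm.1, hkm.2])
  have h3 : (a + l z) - (a + l y) = k := by linarith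
  rw [h3]
  exact hkm

end Lifting

section ConvexLifting

variable {E : Type*} [NormedAddCommGroup E] [NormedSpace ℝ E] {K : Set E} {n m : ℕ}

theorem Convex.isPreconnected_ball_inter_ball (hK : Convex ℝ K) (x y : K) (δ : ℝ) :
    IsPreconnected (Metric.ball x δ ∩ Metric.ball y δ) := by
  rw [← Topology.IsInducing.subtypeVal.isPreconnected_image]
  have : (Subtype.val '' (Metric.ball x δ ∩ Metric.ball y δ) : Set E) =
      K ∩ (Metric.ball (x : E) δ ∩ Metric.ball (y : E) δ) := by
    ext z
    constructor
    · rintro ⟨w, hw, rfl⟩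
      exact ⟨w.2, hw⟩
    · rintro ⟨hz, hw⟩
      exact ⟨⟨z, hz⟩, hw, rfl⟩
  rw [this]
  exact (hK.inter ((convex_ball _ _).inter (convex_ball _ _))).isPreconnected

/-- The point dividing the segment from `x₀` to `x` in the ratio `t : 1 - t`. -/
noncomputable def Convex.segmentPoint (hK : Convex ℝ K) (t : Set.Icc (0 : ℝ) 1) (x₀ x : K) : K :=
  ⟨AffineMap.lineMap (x₀ : E) (x : E) (t : ℝ),
    hK.segment_subset x₀.2 x.2 (lineMap_mem_segment ℝ _ _ t.2)⟩

/-- A locally `m`-varying map from a compact convex set to `ZMod n` lifts to `ℤ` when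
`3 * m < n`. With `δ` a Lebesgue number for the local lifts, the value of the lift at `x` is the
sum of the local increments along a subdivision of the segment from a base point to `x` into steps
shorter than `δ / 2`. -/
theorem exists_isLiftOn_univ (hK : Convex ℝ K) (hKc : IsCompact K) (hmn : 3 * m < n)
    {f : K → ZMod n} (hf : ∀ x, ∀ᶠ y in 𝓝 x, ZMod.cyclicDist (f x) (f y) ≤ m) :
    ∃ L, IsLiftOn m f L Set.univ := by
  rcases isEmpty_or_nonempty K with hE | ⟨⟨x₀⟩⟩
  · exact ⟨fun _ => 0, fun x => isEmptyElim x⟩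
  have : CompactSpace K := isCompact_iff_compactSpace.1 hKc
  choose U hUo hxU L₀ hL₀ using exists_isLiftOn_nhds hmn hf
  obtain ⟨δ, hδ, hδU⟩ := lebesgue_number_lemma_of_metric (isCompact_univ (X := K)) hUo
    (fun x _ => Set.mem_iUnion.2 ⟨x, hxU x⟩)
  choose c hc using fun x => hδU x (Set.mem_univ x)
  -- `L x` is a lift on the ball of radius `δ` around `x`, and `D x` its increment from `x`.
  let L : K → K → ℤ := fun x => L₀ (c x)
  have hL : ∀ x, IsLiftOn m f (L x) (Metric.ball x δ) := fun x => (hL₀ (c x)).mono (hc x)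
  let D : K → K → ℤ := fun x y => L x y - L x x
  have hDL : ∀ x y z : K, dist y x < δ → dist z x < δ → dist z y < δ →
      D y z = L x z - L x y := fun x y z h1 h2 h3 =>
    IsLiftOn.sub_eq_sub (by omega) (Metric.isOpen_ball.inter Metric.isOpen_ball)
      (hK.isPreconnected_ball_inter_ball y x δ) ((hL y).mono Set.inter_subset_left)
      ((hL x).mono Set.inter_subset_right) ⟨Metric.mem_ball_self hδ, h1⟩ ⟨h3, h2⟩
  obtain ⟨R, hR⟩ := (Metric.isBounded_iff (s := K)).1 hKc.isBounded
  obtain ⟨N, hN⟩ := exists_nat_gt (R / (δ / 2))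
  have hR0 : 0 ≤ R := dist_nonneg.trans (hR x₀.2 x₀.2)
  have hN0 : (0 : ℝ) < N := (div_nonneg hR0 (by positivity)).trans_lt hN
  have hmem : ∀ i : ℕ, min ((i : ℝ) / N) 1 ∈ Set.Icc (0 : ℝ) 1 := fun i =>
    ⟨le_min (by positivity) zero_le_one, min_le_right _ _⟩
  let P : ℕ → K → K := fun i x => hK.segmentPoint ⟨_, hmem i⟩ x₀ x
  have hP0 : ∀ x, P 0 x = x₀ := fun x => Subtype.ext (by simp [P, Convex.segmentPoint])
  have hPN : ∀ x, P N x = x := fun x => Subtype.ext (by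
    simp [P, Convex.segmentPoint, div_self hN0.ne'])
  have hPP : ∀ i x y, dist (P i x) (P i y) ≤ dist x y := fun i x y => by
    change dist (AffineMap.lineMap (x₀ : E) (x : E) _) (AffineMap.lineMap (x₀ : E) (y : E) _) ≤ _
    rw [dist_eq_norm, AffineMap.lineMap_apply_module, AffineMap.lineMap_apply_module,
      add_sub_add_left_eq_sub, ← smul_sub, norm_smul, Subtype.dist_eq, dist_eq_norm,
      Real.norm_of_nonneg (hmem i).1]
    exact mul_le_of_le_one_left (norm_nonneg _) (hmem i).2
  have hstep : ∀ i x, dist (P (i + 1) x) (P i x) < δ / 2 := fun i x => by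
    change dist (AffineMap.lineMap (x₀ : E) (x : E) _) (AffineMap.lineMap (x₀ : E) (x : E) _) < _
    rw [dist_lineMap_lineMap]
    have h1 : dist (min (((i + 1 : ℕ) : ℝ) / N) 1) (min ((i : ℝ) / N) 1) ≤ 1 / N := by
      rw [Real.dist_eq]
      refine (abs_min_sub_min_le_max _ _ _ _).trans ?_
      rw [sub_self, abs_zero, Nat.cast_add, Nat.cast_one, ← sub_div, add_sub_cancel_left,
        abs_of_nonneg (by positivity), max_eq_left (by positivity)]
    calc _ ≤ 1 / (N : ℝ) * R := mul_le_mul h1 (hR x₀.2 x.2) dist_nonneg (by positivity)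
      _ < δ / 2 := by
        rw [div_lt_iff₀ (by positivity)] at hN
        rw [one_div, inv_mul_lt_iff₀ hN0]
        linarith
  obtain ⟨a, ha⟩ := ZMod.intCast_surjective (f x₀)
  let G : ℕ → K → ℤ := fun j x => a + ∑ i ∈ Finset.range j, D (P i x) (P (i + 1) x)
  have hGcast : ∀ x j, (G j x : ZMod n) = f (P j x) := fun x j => by
    induction j with
    | zero => simp [G, ha, hP0]
    | succ j ih =>
      have : G (j + 1) x = G j x + D (P j x) (P (j + 1) x) := by
        simp only [G, Finset.sum_range_succ, add_assoc]
      rw [this, Int.cast_add, ih]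
      simp only [D, Int.cast_sub]
      rw [(hL _ _ (Metric.mem_ball_self hδ)).1,
        (hL (P j x) (P (j + 1) x) ((hstep j x).trans (by linarith))).1]
      ring
  -- The increments along two nearby segments differ by the increment between their endpoints.
  have hGsub : ∀ x y, dist y x < δ / 2 → ∀ j, G j y - G j x = D (P j x) (P j y) :=
      fun x y hxy j => by
    induction j with
    | zero => simp [G, D, hP0]
    | succ j ih =>
      have h1 : ∀ x, G (j + 1) x = G j x + D (P j x) (P (j + 1) x) := fun x => by
        simp only [G, Finset.sum_range_succ, add_assoc]
      have h2 := hPP j y x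
      have h3 := hPP (j + 1) y x
      have h4 := hstep j x
      have h5 := hstep j y
      have h6 : dist (P (j + 1) y) (P j x) < δ := by
        linarith [dist_triangle (P (j + 1) y) (P (j + 1) x) (P j x)]
      rw [h1, h1, hDL (P j x) (P (j + 1) x) (P (j + 1) y) (by linarith) h6 (by linarith),
        hDL (P j x) (P j y) (P (j + 1) y) (by linarith) h6 (by linarith)]
      simp only [D] at ih ⊢
      linarith
  refine ⟨G N, fun x _ => ⟨by rw [hGcast, hPN], ?_⟩⟩
  filter_upwards [Metric.ball_mem_nhds x (half_pos hδ), (hL x x (Metric.mem_ball_self hδ)).2]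
    with y hy hLy
  rw [hGsub x y hy, hPN, hPN]
  exact hLy

end ConvexLifting

/-! ### Closure spaces of relations -/

/-- A map from a topological space to the closure space of a symmetric relation `r` is continuous
iff each point has a neighbourhood whose values are all related to the value at the point. -/
theorem CechClosure.isContinuous_iff_eventually {T X : Type} [TopologicalSpace T]
    {c : CechClosure X} {r : X → X → Prop} (hr : ∀ x y, r x y → r y x)
    (hc : ∀ A j, j ∈ c.cl A ↔ ∃ i ∈ A, r i j) {f : T → X} :
    IsContinuous (ofTopology T) c f ↔ ∀ x, ∀ᶠ y in 𝓝 x, r (f x) (f y) := by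
  constructor
  · intro h x
    by_contra hx
    have hcl : x ∈ closure {y | ¬ r (f x) (f y)} :=
      mem_closure_iff_frequently.2 (not_eventually.1 hx)
    obtain ⟨_, ⟨y, hy, rfl⟩, hyx⟩ := (hc _ _).1 (h _ ⟨x, hcl, rfl⟩)
    exact hy (hr _ _ hyx)
  · rintro h A _ ⟨x, hx, rfl⟩
    obtain ⟨y, hyA, hy⟩ := ((mem_closure_iff_frequently.1 hx).and_eventually (h x)).exists
    exact (hc _ _).2 ⟨f y, ⟨y, hyA, rfl⟩, hr _ _ hy⟩

/-- The closure operator on `ℤ` sending `A` to the set of integers at distance at most `m`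
from `A`. -/
def intClosure (m : ℕ) : CechClosure ℤ where
  cl A := {j | ∃ i ∈ A, |j - i| ≤ m}
  cl_empty := by simp
  subset_cl A x hx := ⟨x, hx, by simp⟩
  cl_union A B := by
    ext j
    simp only [Set.mem_union, Set.mem_ofPred_eq, or_and_right, exists_or]

theorem isContinuous_intClosure_iff {T : Type} [TopologicalSpace T] {m : ℕ} {f : T → ℤ} :
    CechClosure.IsContinuous (.ofTopology T) (intClosure m) f ↔
      ∀ x, ∀ᶠ y in 𝓝 x, |f y - f x| ≤ m :=
  CechClosure.isContinuous_iff_eventually (r := fun i j : ℤ => |j - i| ≤ m)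
    (fun x y h => by rwa [abs_sub_comm]) fun _ _ => Iff.rfl

theorem mem_rootsOfUnityClosure {n m : ℕ} {A : Set (ZMod n)} {j : ZMod n} :
    j ∈ (rootsOfUnityClosure n m).cl A ↔ ∃ i ∈ A, ZMod.cyclicDist i j ≤ m := by
  simp [rootsOfUnityClosure]

theorem isContinuous_rootsOfUnityClosure_iff {T : Type} [TopologicalSpace T] {n m : ℕ}
    {f : T → ZMod n} :
    CechClosure.IsContinuous (.ofTopology T) (rootsOfUnityClosure n m) f ↔
      ∀ x, ∀ᶠ y in 𝓝 x, ZMod.cyclicDist (f x) (f y) ≤ m :=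
  CechClosure.isContinuous_iff_eventually (r := fun i j => ZMod.cyclicDist i j ≤ m)
    (fun x y h => by rwa [ZMod.cyclicDist_comm]) fun _ _ => mem_rootsOfUnityClosure

/-- The simplicial map between singular sets induced by a continuous map of closure spaces. -/
noncomputable def CechClosure.singularSetMap {X Y : Type} {c : CechClosure X} {d : CechClosure Y}
    (f : X → Y) (hf : IsContinuous c d f) : c.singularSet ⟶ d.singularSet where
  app _ := TypeCat.ofHom fun σ => ⟨f ∘ σ.1, hf.comp σ.2⟩

theorem isContinuous_intCast (n m : ℕ) :
    CechClosure.IsContinuous (intClosure m) (rootsOfUnityClosure n m)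
      (fun a : ℤ => (a : ZMod n)) := by
  rintro A _ ⟨j, ⟨i, hi, hij⟩, rfl⟩
  exact mem_rootsOfUnityClosure.2
    ⟨_, ⟨i, hi, rfl⟩, (ZMod.cyclicDist_le_iff _ _).2 ⟨j - i, by simp, hij⟩⟩

theorem isContinuous_add_const (m : ℕ) (a : ℤ) :
    CechClosure.IsContinuous (intClosure m) (intClosure m) (· + a) := by
  rintro A _ ⟨j, ⟨i, hi, hij⟩, rfl⟩
  exact ⟨_, ⟨i, hi, rfl⟩, by simpa using hij⟩

/-! ### Cones on singular simplices of `ℤ` -/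

section Cone

namespace stdSimplex

variable {p q : ℕ}

/-- The projection of a simplex from its vertex `0` to the opposite face. At the vertex itself
the value is an arbitrary point. -/
noncomputable def projFromZero (x : stdSimplex ℝ (Fin (p + 1 + 1))) : stdSimplex ℝ (Fin (p + 1)) :=
  if h : x 0 = 1 then vertex 0 else
    ⟨fun i => x i.succ / (1 - x 0), by
      have h1 : x 0 + ∑ i : Fin (p + 1), x i.succ = 1 := by
        rw [← Fin.sum_univ_succ]
        exact stdSimplex.sum_eq_one x
      have h2 : 0 < 1 - x 0 := sub_pos.2 (lt_of_le_of_ne (stdSimplex.le_one x 0) h)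
      refine ⟨fun i => div_nonneg (stdSimplex.zero_le x _) h2.le, ?_⟩
      rw [← Finset.sum_div, div_eq_one_iff_eq h2.ne']
      linarith⟩

theorem projFromZero_apply {x : stdSimplex ℝ (Fin (p + 1 + 1))} (h : x 0 ≠ 1) (i : Fin (p + 1)) :
    projFromZero x i = x i.succ / (1 - x 0) := by
  rw [projFromZero, dif_neg h]
  rfl

theorem continuous_apply {ι : Type*} [Fintype ι] (i : ι) :
    Continuous fun x : stdSimplex ℝ ι => x i :=
  (_root_.continuous_apply i).comp continuous_subtype_val

theorem continuousAt_projFromZero {x : stdSimplex ℝ (Fin (p + 1 + 1))} (h : x 0 ≠ 1) :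
    ContinuousAt projFromZero x := by
  rw [ContinuousAt, tendsto_subtype_rng, tendsto_pi_nhds]
  intro i
  have h1 : Tendsto (fun y : stdSimplex ℝ (Fin (p + 1 + 1)) => y i.succ / (1 - y 0)) (𝓝 x)
      (𝓝 (x i.succ / (1 - x 0))) :=
    (continuous_apply i.succ).continuousAt.div
      (continuous_const.sub (continuous_apply 0)).continuousAt (sub_ne_zero.2 h.symm)
  have h2 := projFromZero_apply h i
  change Tendsto (fun y => projFromZero y i) _ (𝓝 (projFromZero x i))
  rw [h2]
  refine h1.congr' ?_
  filter_upwards [(continuous_apply 0).continuousAt.eventually_ne h] with y hy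
  exact (projFromZero_apply hy i).symm

theorem map_apply {ι κ : Type*} [Fintype ι] [Fintype κ] [DecidableEq κ] (f : ι → κ)
    (x : stdSimplex ℝ ι) (k : κ) :
    map f x k = ∑ i, if f i = k then x i else 0 := by
  rw [map_coe, FunOnFinite.linearMap_apply_apply, Finset.sum_filter]

variable {f : Fin (p + 1) → Fin (q + 1)} {g : Fin (p + 1 + 1) → Fin (q + 1 + 1)}

theorem map_apply_zero (h0 : g 0 = 0) (hs : ∀ i, g i.succ = (f i).succ)
    (x : stdSimplex ℝ (Fin (p + 1 + 1))) : map g x 0 = x 0 := by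
  rw [map_apply, Fin.sum_univ_succ]
  simp [h0, hs]

theorem map_apply_succ (h0 : g 0 = 0) (hs : ∀ i, g i.succ = (f i).succ)
    (x : stdSimplex ℝ (Fin (p + 1 + 1))) (j : Fin (q + 1)) :
    map g x j.succ = ∑ i, if f i = j then x i.succ else 0 := by
  rw [map_apply, Fin.sum_univ_succ]
  simp [h0, hs, (Fin.succ_ne_zero j).symm]

theorem projFromZero_map (h0 : g 0 = 0) (hs : ∀ i, g i.succ = (f i).succ)
    {x : stdSimplex ℝ (Fin (p + 1 + 1))} (h : x 0 ≠ 1) :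
    projFromZero (map g x) = map f (projFromZero x) := by
  refine stdSimplex.ext (funext fun j => ?_)
  rw [projFromZero_apply (by rwa [map_apply_zero h0 hs]), map_apply_zero h0 hs,
    map_apply_succ h0 hs, map_apply, Finset.sum_div]
  refine Finset.sum_congr rfl fun i _ => ?_
  split_ifs
  · rw [projFromZero_apply h]
  · simp

theorem map_succ_apply_zero (x : stdSimplex ℝ (Fin (p + 1))) :
    map Fin.succ x (0 : Fin (p + 1 + 1)) = 0 := by
  rw [map_apply]
  simp

theorem projFromZero_map_succ (x : stdSimplex ℝ (Fin (p + 1))) :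
    projFromZero (map Fin.succ x) = x := by
  refine stdSimplex.ext (funext fun j => ?_)
  rw [projFromZero_apply (by rw [map_succ_apply_zero]; exact zero_ne_one), map_succ_apply_zero,
    map_apply]
  simp

end stdSimplex

theorem round_mono {x y : ℝ} (h : x ≤ y) : round x ≤ round y := by
  rw [round_eq, round_eq]
  exact Int.floor_mono (by linarith)

/-- Rounded scaling of the integers is jointly continuous in the scale `s ∈ [0, 1]` and the
integer `b`, for the closure operator `intClosure m` with `m ≥ 1`. At `t = 1` this uses that
rounding is constant near integers. -/
theorem eventually_abs_round_mul_sub_le {m : ℕ} (hm : 1 ≤ m) {t : ℝ} (ht : t ≤ 1) (a : ℤ) :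
    ∀ᶠ s : ℝ in 𝓝 t, 0 ≤ s → ∀ b : ℤ, |b - a| ≤ m → |round (s * b) - round (t * a)| ≤ m := by
  have hm' : (1 : ℝ) ≤ m := by exact_mod_cast hm
  rcases ht.lt_or_eq with ht | rfl
  · -- For `t < 1` the bounds `t * (a ± m)` lie strictly inside `t * a ± m`.
    have h1 : ∀ᶠ s : ℝ in 𝓝 t, s * (a + m) < t * a + m :=
      ((continuous_id.mul continuous_const).tendsto t).eventually_lt_const
        (by change t * _ < _; nlinarith)
    have h2 : ∀ᶠ s : ℝ in 𝓝 t, t * a - m < s * (a - m) :=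
      ((continuous_id.mul continuous_const).tendsto t).eventually_const_lt
        (by change _ < t * _; nlinarith)
    filter_upwards [h1, h2] with s h1 h2 hs b hb
    rw [abs_le] at hb ⊢
    have hb1 : (b : ℝ) ≤ a + m := by exact_mod_cast (by linarith [hb.2] : b ≤ a + m)
    have hb2 : (a : ℝ) - m ≤ b := by exact_mod_cast (by linarith [hb.1] : a - m ≤ b)
    have h3 : round (s * b) ≤ round (t * a + m) :=
      round_mono ((mul_le_mul_of_nonneg_left hb1 hs).trans h1.le)
    have h4 : round (t * a - m) ≤ round (s * b) :=
      round_mono (h2.le.trans (mul_le_mul_of_nonneg_left hb2 hs))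
    rw [round_add_natCast] at h3
    rw [round_sub_natCast] at h4
    constructor <;> linarith
  · have h1 : ∀ᶠ s : ℝ in 𝓝 1, |s - 1| * (|(a : ℝ)| + m) < 1 / 2 :=
      ((by fun_prop : Continuous fun s : ℝ => |s - 1| * (|(a : ℝ)| + m)).tendsto 1)
        |>.eventually_lt_const (by norm_num)
    filter_upwards [h1] with s h1 hs b hb
    have hb' : |(b : ℝ)| ≤ |(a : ℝ)| + m := by
      have : |(b : ℝ) - a| ≤ m := by exact_mod_cast hb
      linarith [abs_sub_abs_le_abs_sub (b : ℝ) a]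
    have h2 : |s * b - b| < 1 / 2 := by
      rw [show s * b - b = (s - 1) * b by ring, abs_mul]
      exact (mul_le_mul_of_nonneg_left hb' (abs_nonneg _)).trans_lt h1
    have h3 : round (s * (b : ℝ)) = b := by
      rw [abs_lt] at h2
      rw [round_eq_iff, Set.mem_Ico]
      constructor <;> linarith [h2.1, h2.2]
    rw [h3, one_mul, round_intCast]
    exact hb

/-- A continuous map from a compact space to `ℤ` is bounded. -/
theorem exists_abs_le_of_isContinuous {T : Type} [TopologicalSpace T] [CompactSpace T] {m : ℕ}
    {f : T → ℤ} (hf : CechClosure.IsContinuous (.ofTopology T) (intClosure m) f) :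
    ∃ B : ℤ, ∀ x, |f x| ≤ B := by
  suffices ∃ B : ℤ, ∀ x ∈ Set.univ, |f x| ≤ B by simpa using this
  refine isCompact_univ.induction_on (p := fun s => ∃ B : ℤ, ∀ x ∈ s, |f x| ≤ B)
    ⟨0, by simp⟩ (fun s t hst ⟨B, hB⟩ => ⟨B, fun x hx => hB x (hst hx)⟩) ?_ ?_
  · rintro s t ⟨B, hB⟩ ⟨B', hB'⟩
    exact ⟨max B B', fun x hx => hx.elim (fun h => le_max_of_le_left (hB x h))
      fun h => le_max_of_le_right (hB' x h)⟩
  · refine fun x _ => ⟨_, mem_nhdsWithin_of_mem_nhds (isContinuous_intClosure_iff.1 hf x),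
      |f x| + m, fun y hy => ?_⟩
    have hy : |f y - f x| ≤ m := hy
    linarith [abs_sub_abs_le_abs_sub (f y) (f x)]

variable {m p q : ℕ}

/-- The cone on a singular simplex of `ℤ` with apex `0`: along the segment from a point of the
base to the vertex `0`, the value is scaled linearly to `0` and rounded. -/
noncomputable def coneSimplex (hm : 1 ≤ m) (σ : (intClosure m).SingularSimplex p) :
    (intClosure m).SingularSimplex (p + 1) :=
  ⟨fun x => round ((1 - x 0) * σ.1 (stdSimplex.projFromZero x)), by
    have hc := stdSimplex.continuous_apply (0 : Fin (p + 1 + 1))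
    refine isContinuous_intClosure_iff.2 fun x => ?_
    by_cases hx : x 0 = 1
    · -- At the apex, scaled values are eventually less than `1 / 2`, since `σ` is bounded.
      obtain ⟨B, hB⟩ := exists_abs_le_of_isContinuous σ.2
      have h1 : ∀ᶠ y in 𝓝 x, (1 - y 0) * (B : ℝ) < 1 / 2 :=
        (((continuous_const.sub hc).mul continuous_const).tendsto x).eventually_lt_const
          (by simp [hx])
      filter_upwards [h1] with y hy
      have h2 : |(1 - y 0) * (σ.1 (stdSimplex.projFromZero y) : ℝ)| < 1 / 2 := by
        rw [abs_mul, abs_of_nonneg (sub_nonneg.2 (stdSimplex.le_one y 0))]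
        refine lt_of_le_of_lt (mul_le_mul_of_nonneg_left ?_
          (sub_nonneg.2 (stdSimplex.le_one y 0))) hy
        exact_mod_cast hB _
      have h3 : round ((1 - y 0) * (σ.1 (stdSimplex.projFromZero y) : ℝ)) = 0 := by
        rw [abs_lt] at h2
        rw [round_eq_zero_iff, Set.mem_Ico]
        exact ⟨h2.1.le, h2.2⟩
      rw [h3, hx]
      simp
    · filter_upwards [((continuous_const.sub hc).tendsto x).eventually
          (eventually_abs_round_mul_sub_le hm (sub_le_self 1 (stdSimplex.zero_le x 0))
            (σ.1 (stdSimplex.projFromZero x))),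
        (stdSimplex.continuousAt_projFromZero hx).eventually
          (isContinuous_intClosure_iff.1 σ.2 (stdSimplex.projFromZero x))] with y h1 h2
      exact h1 (sub_nonneg.2 (stdSimplex.le_one y 0)) _ h2⟩

/-- Cones are natural for vertex maps `g` that extend `f` by fixing the apex. -/
theorem coneSimplex_pullback (hm : 1 ≤ m) {f : Fin (p + 1) → Fin (q + 1)}
    {g : Fin (p + 1 + 1) → Fin (q + 1 + 1)} (h0 : g 0 = 0) (hs : ∀ i, g i.succ = (f i).succ)
    (σ : (intClosure m).SingularSimplex q) :
    (coneSimplex hm σ).pullback g = coneSimplex hm (σ.pullback f) := by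
  refine Subtype.ext (funext fun x => ?_)
  change round ((1 - stdSimplex.map g x 0) *
    (σ.1 (stdSimplex.projFromZero (stdSimplex.map g x)) : ℝ)) = round ((1 - x 0) * (σ.1 (stdSimplex.map f (stdSimplex.projFromZero x)) : ℝ))
  rw [stdSimplex.map_apply_zero h0 hs]
  by_cases hx : x 0 = 1
  · simp [hx]
  · rw [stdSimplex.projFromZero_map h0 hs hx]

theorem coneSimplex_pullback_succ (hm : 1 ≤ m) (σ : (intClosure m).SingularSimplex p) :
    (coneSimplex hm σ).pullback Fin.succ = σ := by
  refine Subtype.ext (funext fun x => ?_)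
  change round ((1 - stdSimplex.map Fin.succ x 0) *
    (σ.1 (stdSimplex.projFromZero (stdSimplex.map Fin.succ x)) : ℝ)) = σ.1 x
  rw [stdSimplex.map_succ_apply_zero, stdSimplex.projFromZero_map_succ]
  simp

theorem coneSimplex_pullback_zero (hm : 1 ≤ m) (σ : (intClosure m).SingularSimplex 0)
    {g : Fin 1 → Fin 2} (hg : g 0 = 0) (x : stdSimplex ℝ (Fin 1)) :
    ((coneSimplex hm σ).pullback g).1 x = 0 := by
  change round ((1 - stdSimplex.map g x 0) *
    (σ.1 (stdSimplex.projFromZero (stdSimplex.map g x)) : ℝ)) = 0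
  have : stdSimplex.map g x 0 = 1 := by
    have hg' : g = fun _ => 0 := funext fun i => by rw [Subsingleton.elim i 0, hg]
    rw [stdSimplex.map_apply]
    simp [hg']
  simp [this]

end Cone

/-! ### Quotients of simplicial sets by free actions of `ℤ` -/

section Algebra
open Limits Simplicial Opposite

/-- Every function on `ℤ` is a difference: it can be summed in both directions from `0`. -/
theorem Int.exists_sub_eq {A : Type*} [AddCommGroup A] (g : ℤ → A) :
    ∃ P : ℤ → A, ∀ a, P (a + 1) - P a = g a := by
  refine ⟨fun a => ∑ j ∈ Finset.Ico 0 a, g j - ∑ j ∈ Finset.Ico a 0, g j, fun a => ?_⟩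
  beta_reduce
  rcases le_or_gt 0 a with h | h
  · rw [Finset.Ico_eq_empty (by omega : ¬ a + 1 < 0), Finset.Ico_eq_empty (by omega : ¬ a < 0),
      ← Finset.insert_Ico_right_eq_Ico_add_one h, Finset.sum_insert Finset.right_notMem_Ico]
    abel
  · rw [Finset.Ico_eq_empty (by omega : ¬ 0 < a + 1), Finset.Ico_eq_empty (by omega : ¬ 0 < a),
      ← Finset.insert_Ico_add_one_left_eq_Ico h, Finset.sum_insert (by simp)]
    abel

namespace SSet

variable {C : Type*} [Category C] [Abelian C] [HasCoproducts.{0} C] {X Y : SSet.{0}}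

variable (R : C)

variable {R} in
/-- The morphism from the simplicial `p`-chains given by its values on simplices. -/
noncomputable def chainDesc {p : ℕ} {Z : C} (k : X _⦋p⦌ → (R ⟶ Z)) :
    (X.chainComplex R).X p ⟶ Z :=
  Cofan.IsColimit.desc (X.isColimitChainComplexXCofan R p) k

variable {R} in
theorem ι_chainDesc {p : ℕ} {Z : C} (k : X _⦋p⦌ → (R ⟶ Z)) (x : X _⦋p⦌) :
    X.ιChainComplex x ≫ chainDesc k = k x :=
  Cofan.IsColimit.fac (X.isColimitChainComplexXCofan R p) k x

/-- `π` presents `X` as the quotient of `Y` by a free action of `ℤ`, with generator `T`. Freeness is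
encoded by a trivialization in each degree, which need not respect the simplicial operators. -/
structure IsFreeQuotient (T : Y ⟶ Y) (π : Y ⟶ X) : Prop where
  comp_eq : T ≫ π = π
  exists_equiv (p : ℕ) : ∃ e : ℤ × X _⦋p⦌ ≃ Y _⦋p⦌,
    (∀ a b, T.app _ (e (a, b)) = e (a + 1, b)) ∧ ∀ a b, π.app _ (e (a, b)) = b

variable {T : Y ⟶ Y} {π : Y ⟶ X}

/-- The sequence of chain complexes `C(Y) ⟶ C(Y) ⟶ C(X)` given by `T - 1` and `π`. -/
noncomputable def IsFreeQuotient.shortComplex (h : IsFreeQuotient T π) :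
    ShortComplex (ChainComplex C ℕ) :=
  ShortComplex.mk (chainComplexMap T R - 𝟙 _) (chainComplexMap π R) (by
    rw [Preadditive.sub_comp, Category.id_comp, ← Functor.map_comp, h.comp_eq, sub_self])

/-- In each degree the chains of `Y` are a direct sum, over the simplices of `X`, of copies of the
regular representation of `ℤ`. There `T - 1` is a split monomorphism, and `π` is its cokernel because
a morphism killed by `T - 1` is constant on orbits. -/
theorem IsFreeQuotient.shortExact (h : IsFreeQuotient T π) : (h.shortComplex R).ShortExact := by
  refine HomologicalComplex.shortExact_of_degreewise_shortExact _ fun p => ?_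
  obtain ⟨e, hT, hπ⟩ := h.exists_equiv p
  have hι : ∀ a b, Y.ιChainComplex (e (a, b)) ≫ (chainComplexMap T R - 𝟙 _).f p =
      Y.ιChainComplex (e (a + 1, b)) - Y.ιChainComplex (e (a, b)) := fun a b => by
    rw [HomologicalComplex.sub_f_apply, Preadditive.comp_sub, HomologicalComplex.id_f,
      Category.comp_id, ι_chainComplexMap_f, hT]
  have hιπ : ∀ a b, Y.ιChainComplex (e (a, b)) ≫ (chainComplexMap π R).f p =
      X.ιChainComplex b := fun a b => by
    rw [ι_chainComplexMap_f, hπ]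
  choose P hP using fun b => Int.exists_sub_eq
    fun a => (Y.ιChainComplex (e (a, b)) : R ⟶ (Y.chainComplex R).X p)
  have hmono : Mono ((chainComplexMap T R - 𝟙 _).f p) := by
    -- The retraction sends a simplex to a sum over the orbit from the base simplex to it.
    have hr : (chainComplexMap T R - 𝟙 _).f p ≫
        chainDesc (fun y => P (e.symm y).2 (e.symm y).1) = 𝟙 ((Y.chainComplex R).X p) := by
      ext y
      obtain ⟨⟨a, b⟩, rfl⟩ := e.surjective y
      rw [← Category.assoc, hι, Preadditive.sub_comp, ι_chainDesc, ι_chainDesc,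
        e.symm_apply_apply, e.symm_apply_apply, hP, Category.comp_id]
    exact mono_of_mono_fac hr
  have hepi : Epi ((chainComplexMap π R).f p) := by
    refine ⟨fun u v huv => ?_⟩
    ext b
    rw [← hιπ 0 b, Category.assoc, huv, Category.assoc]
  have hcok : IsColimit (CokernelCofork.ofπ (f := (chainComplexMap T R - 𝟙 _).f p)
      ((chainComplexMap π R).f p) (((h.shortComplex R).map
        (HomologicalComplex.eval C _ p)).zero)) := by
    refine CokernelCofork.IsColimit.ofπ' _ _ fun {Z} k hk => ?_
    have hk' : ∀ a b, Y.ιChainComplex (e (a, b)) ≫ k = Y.ιChainComplex (e (0, b)) ≫ k :=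
        fun a b => by
      have h1 : ∀ a, Y.ιChainComplex (e (a + 1, b)) ≫ k = Y.ιChainComplex (e (a, b)) ≫ k :=
          fun a => by
        have := congrArg (Y.ιChainComplex (e (a, b)) ≫ ·) hk
        simp only [comp_zero] at this
        rw [← Category.assoc, hι, Preadditive.sub_comp, sub_eq_zero] at this
        exact this
      induction a using Int.induction_on with
      | zero => rfl
      | succ i ih => rw [h1, ih]
      | pred i ih => rw [← ih, ← h1 (-(i : ℤ) - 1), sub_add_cancel]
    refine ⟨chainDesc fun b => Y.ιChainComplex (e (0, b)) ≫ k, ?_⟩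
    ext y
    obtain ⟨⟨a, b⟩, rfl⟩ := e.surjective y
    rw [← Category.assoc, hιπ, hk', ι_chainDesc]
  exact
    { exact := ShortComplex.exact_of_g_is_cokernel _ hcok
      mono_f := hmono
      epi_g := hepi }

variable (Y) in
/-- A simplicial set augmented over a point. -/
noncomputable def augmentedPUnit : SimplicialObject.Augmented (Type) where
  left := Y
  right := PUnit
  hom := { app _ := TypeCat.ofHom fun _ => PUnit.unit }

/-- The coefficient object, as a coproduct over a point. -/
noncomputable abbrev pointCoeff (R : C) : C := (sigmaConst.obj R).obj PUnit

/-- An extra degeneracy makes the augmentation of the chain complex a homotopy equivalence. -/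
noncomputable def chainHomotopyEquiv (ed : Y.augmentedPUnit.ExtraDegeneracy) :
    HomotopyEquiv (Y.chainComplex R) ((ChainComplex.single₀ C).obj (pointCoeff R)) :=
  (ed.map (sigmaConst.obj R)).homotopyEquiv

theorem chainComplexMap_comp_chainHomotopyEquiv (ed : Y.augmentedPUnit.ExtraDegeneracy)
    (T : Y ⟶ Y) :
    chainComplexMap T R ≫ (chainHomotopyEquiv R ed).hom = (chainHomotopyEquiv R ed).hom := by
  let F : Y.augmentedPUnit ⟶ Y.augmentedPUnit := { left := T, right := 𝟙 _ }
  have := (AlgebraicTopology.AlternatingFaceMapComplex.ε (C := C)).naturality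
    (((SimplicialObject.Augmented.whiskering _ _).obj (sigmaConst.obj R)).map F)
  have h2 : (SimplicialObject.Augmented.point ⋙ ChainComplex.single₀ C).map
    (((SimplicialObject.Augmented.whiskering _ _).obj (sigmaConst.obj R)).map F) = 𝟙 _ := by
    exact ((ChainComplex.single₀ C).congr_map ((sigmaConst.obj R).map_id PUnit)).trans
      ((ChainComplex.single₀ C).map_id _)
  rw [h2, Category.comp_id] at this
  exact this

theorem isZero_homology_of_extraDegeneracy (ed : Y.augmentedPUnit.ExtraDegeneracy) (k : ℕ) :
    IsZero (Y.homology R (k + 1)) :=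
  (HomologicalComplex.isZero_single_obj_homology _ 0 _ _ k.succ_ne_zero).of_iso
    ((chainHomotopyEquiv R ed).toHomologyIso (k + 1))

/-- The zeroth homology of a simplicial set with an extra degeneracy. -/
noncomputable def homologyZeroIso (ed : Y.augmentedPUnit.ExtraDegeneracy) :
    Y.homology R 0 ≅ pointCoeff R :=
  (chainHomotopyEquiv R ed).toHomologyIso 0 ≪≫
    HomologicalComplex.singleObjHomologySelfIso _ 0 (pointCoeff R)

/-- An endomorphism acts as the identity on the homology of a simplicial set with an extra
degeneracy, because it commutes with the augmentation. -/
theorem homologyMap_eq_id (ed : Y.augmentedPUnit.ExtraDegeneracy) (T : Y ⟶ Y) (k : ℕ) :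
    SSet.homologyMap T R k = 𝟙 _ := by
  have h := congrArg (fun f => HomologicalComplex.homologyMap f k)
    (chainComplexMap_comp_chainHomotopyEquiv R ed T)
  simp only [HomologicalComplex.homologyMap_comp] at h
  have : IsIso (HomologicalComplex.homologyMap (chainHomotopyEquiv R ed).hom k) :=
    inferInstanceAs (IsIso ((chainHomotopyEquiv R ed).toHomologyIso k).hom)
  rw [← cancel_mono (HomologicalComplex.homologyMap (chainHomotopyEquiv R ed).hom k), h,
    Category.id_comp]

theorem IsFreeQuotient.homologyMap_shortComplex_f (h : IsFreeQuotient T π)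
    (ed : Y.augmentedPUnit.ExtraDegeneracy) (k : ℕ) :
    HomologicalComplex.homologyMap (h.shortComplex R).f k = 0 := by
  have h1 : HomologicalComplex.homologyMap (chainComplexMap T R - 𝟙 (Y.chainComplex R)) k = 0 := by
    rw [HomologicalComplex.homologyMap_sub, HomologicalComplex.homologyMap_id, sub_eq_zero]
    exact homologyMap_eq_id R ed T k
  exact h1

/-- The quotient of a contractible simplicial set by a free action of `ℤ` has the homology of the
circle. In the long exact sequence of `0 ⟶ C(Y) ⟶ C(Y) ⟶ C(X) ⟶ 0` the map `T - 1` vanishes in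
homology, and `Y` has homology only in degree `0`. -/
theorem IsFreeQuotient.homology (h : IsFreeQuotient T π)
    (ed : Y.augmentedPUnit.ExtraDegeneracy) :
    Nonempty (X.homology R 0 ≅ pointCoeff R) ∧ Nonempty (X.homology R 1 ≅ pointCoeff R) ∧
      ∀ k, IsZero (X.homology R (k + 2)) := by
  have hS := h.shortExact R
  have hY := isZero_homology_of_extraDegeneracy R ed
  have h0 := h.homologyMap_shortComplex_f R ed
  refine ⟨?_, ?_, fun k => ?_⟩
  · have hmono : Mono (HomologicalComplex.homologyMap (h.shortComplex R).g 0) :=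
      (hS.homology_exact₂ 0).mono_g (h0 0)
    have hepi : Epi (HomologicalComplex.homologyMap (h.shortComplex R).g 0) := by
      have := hS.epi_g
      exact HomologicalComplex.epi_homologyMap_of_epi_of_not_rel _ _ (by simp)
    have := isIso_of_mono_of_epi (HomologicalComplex.homologyMap (h.shortComplex R).g 0)
    exact ⟨(asIso (HomologicalComplex.homologyMap (h.shortComplex R).g 0)).symm ≪≫
      homologyZeroIso R ed⟩
  · have hmono : Mono (hS.δ 1 0 rfl) := hS.mono_δ _ _ _ (hY 0)
    have hepi : Epi (hS.δ 1 0 rfl) := (hS.homology_exact₁ 1 0 rfl).epi_f (h0 0)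
    have := isIso_of_mono_of_epi (hS.δ 1 0 rfl)
    let e := asIso (hS.δ 1 0 rfl)
    exact ⟨e ≪≫ homologyZeroIso R ed⟩
  · exact (hY k).of_iso (hS.δIso (k + 2) (k + 1) rfl (hY (k + 1)) (hY k))

end SSet
end Algebra

/-! ### The covering of `ℤ/n` by `ℤ` -/

section Covering
open Limits Simplicial Opposite

/-- The reduction modulo `n` on singular sets. -/
noncomputable def reduction (n m : ℕ) :
    (intClosure m).singularSet ⟶ (rootsOfUnityClosure n m).singularSet :=
  CechClosure.singularSetMap _ (isContinuous_intCast n m)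

/-- The translation by `n` on the singular set of `ℤ`. -/
noncomputable def translation (n m : ℕ) :
    (intClosure m).singularSet ⟶ (intClosure m).singularSet :=
  CechClosure.singularSetMap _ (isContinuous_add_const m n)

variable {n m : ℕ}

/-- Every singular simplex of `(ℤ/n, c_m)` lifts to `ℤ`. -/
theorem exists_lift (hmn : 3 * m < n) {p : ℕ}
    (σ : (rootsOfUnityClosure n m).SingularSimplex p) :
    ∃ τ : (intClosure m).SingularSimplex p, ∀ x, (τ.1 x : ZMod n) = σ.1 x := by
  obtain ⟨L, hL⟩ := exists_isLiftOn_univ (convex_stdSimplex ℝ (Fin (p + 1)))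
    (isCompact_stdSimplex ℝ (Fin (p + 1))) hmn (isContinuous_rootsOfUnityClosure_iff.1 σ.2)
  exact ⟨⟨L, isContinuous_intClosure_iff.2 fun x => (hL x trivial).2⟩,
    fun x => (hL x trivial).1⟩

theorem exists_eq_add_mul_of_lifts (hmn : 3 * m < n) {p : ℕ}
    {σ : (rootsOfUnityClosure n m).SingularSimplex p} {τ τ' : (intClosure m).SingularSimplex p}
    (hτ : ∀ x, (τ.1 x : ZMod n) = σ.1 x) (hτ' : ∀ x, (τ'.1 x : ZMod n) = σ.1 x) :
    ∃ a : ℤ, ∀ x, τ'.1 x = τ.1 x + a * n := by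
  have h1 : IsLiftOn m σ.1 τ.1 Set.univ :=
    fun x _ => ⟨hτ x, isContinuous_intClosure_iff.1 τ.2 x⟩
  have h2 : IsLiftOn m σ.1 τ'.1 Set.univ :=
    fun x _ => ⟨hτ' x, isContinuous_intClosure_iff.1 τ'.2 x⟩
  let x₀ : stdSimplex ℝ (Fin (p + 1)) := stdSimplex.vertex 0
  have hd : (n : ℤ) ∣ τ'.1 x₀ - τ.1 x₀ := by
    rw [← ZMod.intCast_zmod_eq_zero_iff_dvd]
    push_cast
    rw [hτ, hτ', sub_self]
  obtain ⟨a, ha⟩ := hd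
  refine ⟨a, fun x => ?_⟩
  have := h1.sub_eq_sub (by omega) isOpen_univ isPreconnected_univ h2 (Set.mem_univ x₀)
    (Set.mem_univ x)
  linarith

/-- When `3 * m < n`, the singular set of `(ℤ/n, c_m)` is the quotient of that of `ℤ` by the free
action of translations by multiples of `n`. -/
theorem isFreeQuotient_reduction (hmn : 3 * m < n) :
    SSet.IsFreeQuotient (translation n m) (reduction n m) where
  comp_eq := by
    ext p σ
    refine Subtype.ext (funext fun x => ?_)
    change ((σ.1 x + (n : ℤ) : ℤ) : ZMod n) = (σ.1 x : ZMod n)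
    simp
  exists_equiv p := by
    -- A chosen lift in each orbit trivializes the action.
    choose s hs using fun σ : (rootsOfUnityClosure n m).SingularSimplex p => exists_lift hmn σ
    let F : ℤ × (rootsOfUnityClosure n m).SingularSimplex p → (intClosure m).SingularSimplex p :=
      fun w => ⟨fun x => (s w.2).1 x + w.1 * n, (isContinuous_add_const m (w.1 * n)).comp (s w.2).2⟩
    have hF : ∀ w x, ((F w).1 x : ZMod n) = w.2.1 x := fun w x => by
      simp [F, hs]
    have hn : (n : ℤ) ≠ 0 := by
      have : n ≠ 0 := by omega
      exact_mod_cast this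
    have hbij : Function.Bijective F := by
      constructor
      · rintro ⟨a, b⟩ ⟨a', b'⟩ h
        obtain rfl : b = b' := Subtype.ext (funext fun x => by
          rw [← hF (a, b) x, h, hF])
        have := congrFun (congrArg Subtype.val h) (stdSimplex.vertex 0)
        simp only [F, add_right_inj] at this
        rw [mul_right_cancel₀ hn this]
      · intro τ
        let σ : (rootsOfUnityClosure n m).SingularSimplex p :=
          ⟨_, (isContinuous_intCast n m).comp τ.2⟩
        obtain ⟨a, ha⟩ := exists_eq_add_mul_of_lifts hmn (hs σ) (τ' := τ) fun x => rfl
        exact ⟨(a, σ), Subtype.ext (funext fun x => (ha x).symm)⟩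
    refine ⟨Equiv.ofBijective F hbij, fun a b => Subtype.ext (funext fun x => ?_),
      fun a b => Subtype.ext (funext fun x => hF (a, b) x)⟩
    change (s b).1 x + a * n + n = (s b).1 x + (a + 1) * n
    ring

/-- The cones with apex `0` form an extra degeneracy of the singular set of `ℤ`. -/
noncomputable def intExtraDegeneracy (hm : 1 ≤ m) :
    (intClosure m).singularSet.augmentedPUnit.ExtraDegeneracy where
  s' := TypeCat.ofHom fun _ => ⟨fun _ => 0, isContinuous_intClosure_iff.2 fun x => by simp⟩
  s p := TypeCat.ofHom fun σ => coneSimplex hm σ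
  s'_comp_ε := by
    ext x
    exact Subsingleton.elim (α := PUnit) _ _
  s₀_comp_δ₁ := by
    ext σ
    refine Subtype.ext (funext fun x => ?_)
    exact coneSimplex_pullback_zero hm σ rfl x
  s_comp_δ₀ p := by
    ext σ
    exact coneSimplex_pullback_succ hm σ
  s_comp_δ p i := by
    ext σ
    exact coneSimplex_pullback hm (Fin.succ_succAbove_zero i) (Fin.succ_succAbove_succ i) σ
  s_comp_σ p i := by
    ext σ
    exact coneSimplex_pullback hm rfl (fun j => Fin.succ_predAbove_succ i j) σ

/-- When `1 ≤ m` and `3 * m < n`, the closure space `(ℤ/n, c_m)` has the homology of a circle. -/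
theorem singularHomology_rootsOfUnityClosure (hm : 1 ≤ m) (hmn : 3 * m < n) :
    Nonempty ((rootsOfUnityClosure n m).singularHomology 0 ≅
      SSet.pointCoeff (ModuleCat.of ℤ ℤ)) ∧
    Nonempty ((rootsOfUnityClosure n m).singularHomology 1 ≅
      SSet.pointCoeff (ModuleCat.of ℤ ℤ)) ∧
    ∀ k, IsZero ((rootsOfUnityClosure n m).singularHomology (k + 2)) :=
  (isFreeQuotient_reduction hmn).homology _ (intExtraDegeneracy hm)

end Covering

theorem mainTheorem11 (m : ℕ) (hm : 5 ≤ m) (k : ℕ) :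
    Nonempty ((rootsOfUnityClosure (4 * m - 4) m).singularHomology k ≃+
      (rootsOfUnityClosure (4 * m) (m + 1)).singularHomology k) := by
  obtain ⟨⟨a₀⟩, ⟨a₁⟩, a₂⟩ := singularHomology_rootsOfUnityClosure (n := 4 * m - 4) (m := m)
    (by omega) (by omega)
  obtain ⟨⟨b₀⟩, ⟨b₁⟩, b₂⟩ := singularHomology_rootsOfUnityClosure (n := 4 * m) (m := m + 1)
    (by omega) (by omega)
  suffices Nonempty ((rootsOfUnityClosure (4 * m - 4) m).singularHomology k ≅
      (rootsOfUnityClosure (4 * m) (m + 1)).singularHomology k) from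
    this.map fun e => e.toLinearEquiv.toAddEquiv
  match k with
  | 0 => exact ⟨a₀ ≪≫ b₀.symm⟩
  | 1 => exact ⟨a₁ ≪≫ b₁.symm⟩
  | k + 2 => exact ⟨(a₂ k).iso (b₂ k)⟩
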